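/- Let $F$ be a field of characteristic $2$. For a (finite-dimensional) central simple $F$-algebra $B$ of degree $n$ (so $\dim_F B=n^2$) and $b\in B$, let $$x^n-t_1(b)x^{n-1}+t_2(b)x^{n-2}-\cdots+(-1)^nt_n(b)\in F[x]$$ be the reduced characteristic polynomial of $b$, i.e. $\det(xI_n-\phi(b))$ where $\phi\colon B\otimes_FE\cong M_n(E)$ is a splitting representation of $B$ over some extension field $E$ of $F$; put $t_2=0$ if $n=1$. The second trace form $T_{B/F}$ is the quadratic form $(B,t_2)$ if $n$ is even, and $(\ker t_1,t_2)$ if $n$ is odd. For $a,b\in F$ let $[a,b]$ be the quadratic form $ax^2+xy+by^2$ on $F^2$, and let $\mathbb H=[0,0]$. Two quadratic forms $q,q'$ over $F$ are Witt equivalent if $q\perp r\,\mathbb H$ and $q'\perp s\,\mathbb H$ are isometric for some integers $r,s\ge 0$. Let $A$ be a central simple algebra over $F$. Then $T_{A\otimes_F A/F}$ is Witt equivalent to $[1,1]$ if $\deg A\equiv 2 \pmod 4$, and to $\mathbb H$ otherwise. -/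

import Mathlib

open scoped TensorProduct Polynomial

universe u v w

namespace SecondTrace

noncomputable section

/-- The degree of a central simple algebra `A` over `F`: the natural number `n` with
`dim_F A = n ^ 2` (the dimension of a central simple algebra is a perfect square). -/
def degree (F : Type u) (A : Type v) [Field F] [Ring A] [Algebra F A] : ℕ :=
  Nat.sqrt (Module.finrank F A)

/-- A splitting representation of `A` over the extension field `E` of `F`: an isomorphism of
`E`-algebras from the scalar extension of `A` to the algebra of `n × n` matrices, `n = deg A`. -/
abbrev SplittingRep (F : Type u) (A : Type v) (E : Type w) [Field F] [Ring A] [Algebra F A]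
    [Field E] [Algebra F E] : Type (max v w) :=
  (E ⊗[F] A) ≃ₐ[E] Matrix (Fin (degree F A)) (Fin (degree F A)) E

/-- The polynomial `p` over `F` is the reduced polynomial of `a`: over a splitting field `E`, with
splitting representation `φ`, it becomes `det (X • 1 - φ a)`. -/
def IsReducedPoly (F : Type u) {A : Type v} [Field F] [Ring A] [Algebra F A]
    (a : A) (p : F[X]) : Prop :=
  ∃ (E : Type u) (_ : Field E) (_ : Algebra F E) (φ : SplittingRep F A E),
    p.map (algebraMap F E) = (φ (1 ⊗ₜ[F] a)).charpoly

/-- The reduced polynomial of `a`, the only polynomial over `F` that satisfies `IsReducedPoly`. -/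
def reducedPoly (F : Type u) {A : Type v} [Field F] [Ring A] [Algebra F A] (a : A) : F[X] :=
  Classical.epsilon fun p => IsReducedPoly F a p

/-- The signed coefficients `t_k` of the reduced polynomial
`X ^ n - t_1 X ^ (n-1) + t_2 X ^ (n-2) - ⋯ + (-1) ^ n t_n`, with `t_k = 0` for `k > n`. -/
def t (F : Type u) {A : Type v} [Field F] [Ring A] [Algebra F A] (k : ℕ) (a : A) : F :=
  if k ≤ degree F A then (-1) ^ k * (reducedPoly F a).coeff (degree F A - k) else 0

/-- The reduced trace `t_1`, as a linear form: the linear form whose values are those of `t_1`. -/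
def reducedTrace (F : Type u) (A : Type v) [Field F] [Ring A] [Algebra F A] : A →ₗ[F] F :=
  Classical.epsilon fun f : A →ₗ[F] F => ∀ a, f a = t F 1 a

/-- The map `t_2`, as a quadratic form: the quadratic form whose values are those of `t_2`. -/
def t2Form (F : Type u) (A : Type v) [Field F] [Ring A] [Algebra F A] : QuadraticForm F A :=
  Classical.epsilon fun Q : QuadraticForm F A => ∀ a, Q a = t F 2 a

open Classical in
/-- The space that carries the second trace form: all of `A` if the degree is even, the kernel
of the reduced trace if the degree is odd. -/
def traceFormSpace (F : Type u) (A : Type v) [Field F] [Ring A] [Algebra F A] : Submodule F A :=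
  if Even (degree F A) then ⊤ else LinearMap.ker (reducedTrace F A)

/-- The second trace form `T_{A/F}`: the restriction of `t_2` to `traceFormSpace F A`. -/
def secondTraceForm (F : Type u) (A : Type v) [Field F] [Ring A] [Algebra F A] :
    QuadraticForm F (traceFormSpace F A) :=
  (t2Form F A).comp (traceFormSpace F A).subtype

/-- The binary quadratic form `[a, b] = a x ^ 2 + x y + b y ^ 2`. -/
def binaryForm {F : Type u} [Field F] (a b : F) : QuadraticForm F (F × F) :=
  a • QuadraticMap.linMulLin (LinearMap.fst F F F) (LinearMap.fst F F F)
    + QuadraticMap.linMulLin (LinearMap.fst F F F) (LinearMap.snd F F F)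
    + b • QuadraticMap.linMulLin (LinearMap.snd F F F) (LinearMap.snd F F F)

/-- The hyperbolic plane `[0, 0]`. -/
def hyperbolicPlane (F : Type u) [Field F] : QuadraticForm F (F × F) :=
  binaryForm 0 0

/-- The orthogonal sum of `m` hyperbolic planes. -/
def hyperbolicSpace (F : Type u) [Field F] (m : ℕ) : QuadraticForm F (Fin m → F × F) :=
  QuadraticMap.pi fun _ => hyperbolicPlane F

/-- Witt equivalence: the forms become isometric after adding hyperbolic planes to both. (A form
that is Witt equivalent to a nonsingular one is itself nonsingular.) -/
def WittEquivalent {F : Type u} [Field F] {V : Type v} {W : Type w}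
    [AddCommGroup V] [Module F V] [AddCommGroup W] [Module F W]
    (Q : QuadraticForm F V) (R : QuadraticForm F W) : Prop :=
  ∃ m n : ℕ, QuadraticMap.Equivalent
    (Q.prod (hyperbolicSpace F m)) (R.prod (hyperbolicSpace F n))

end

end SecondTrace

/-! Over a splitting field, Newton's identity shows that the polar form of `t_2` is `t_1(x) t_1(y) -
t_1(xy)`. On pure tensors `t_1` is multiplicative, and in characteristic 2 `t_2(a ⊗ b) = t_1(a)^2
t_2(b) + t_2(a) t_1(b)^2`. So tensors of trace-zero elements are singular, and pair by the product
of the traces. As `t_1(x^2) = t_1(x)^2`, the trace pairing is alternating on trace-zero elements.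
Let `W` be the complement in `A` of `1` (odd degree) or of a plane spanned by `1` and some `g` with
`t_1(g) = 1` (even degree). A symplectic basis `e, f` of `W` makes the tensors `e_i ⊗ w` half of a
hyperbolic space `W ⊗ W`. The mixed summands are hyperbolic too. In odd degree nothing else remains
on the trace-zero space. In even degree one plane `[c, c]` remains, with `c = t_2(1) = n(n-1)/2`,
which is 1 in `F` exactly when `n` is 2 mod 4. These forms over `F` come from Galois descent: the
separable closure splits `A`, and reduced polynomials are the unique monic `n`-th roots of
characteristic polynomials of left multiplications. The main steps are `wittEquivalent_of_even` and
`wittEquivalent_of_odd`. -/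

namespace SecondTrace
-- The second coefficient of the characteristic polynomial of a matrix
open Matrix Polynomial

variable {n m R S : Type*} [Fintype n] [DecidableEq n] [Fintype m] [DecidableEq m]
  [CommRing R] [CommRing S]

/-- The second elementary symmetric function of the eigenvalues of a square matrix. -/
noncomputable def matrixE2 (M : Matrix n n R) : R := M.charpolyRev.coeff 2

theorem charpolyRev_map (M : Matrix n n R) (f : R →+* S) :
    (M.map f).charpolyRev = M.charpolyRev.map f := by
  rw [charpolyRev, charpolyRev, ← Polynomial.coe_mapRingHom, RingHom.map_det]
  congr 1
  ext i j : 2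
  by_cases h : i = j <;> simp [h]

theorem matrixE2_map (M : Matrix n n R) (f : R →+* S) : matrixE2 (M.map f) = f (matrixE2 M) := by
  rw [matrixE2, charpolyRev_map, coeff_map, matrixE2]

/-- This is `(1 - XM)(1 + XM) = 1 - X^2 M^2` under the determinant; its `X^2` coefficient is
Newton's identity. -/
theorem charpolyRev_mul_charpolyRev_neg (M : Matrix n n R) :
    M.charpolyRev * (-M).charpolyRev = expand R 2 (M * M).charpolyRev := by
  rw [charpolyRev, charpolyRev, charpolyRev, ← det_mul, AlgHom.map_det]
  congr 1
  have h : (-M).map C = - M.map C := by ext i j : 2; simp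
  have h2 : (M * M).map C = M.map C * M.map C := Matrix.map_mul
  have h3 (N : Matrix n n R) : (expand R 2).mapMatrix (1 - (X : R[X]) • N.map C) =
      1 - (X ^ 2 : R[X]) • N.map C := by
    ext i j : 2
    by_cases h : i = j <;> simp [h]
  rw [h, h3, h2, smul_neg, sub_neg_eq_add, sub_mul, one_mul, mul_add, mul_one,
    Matrix.smul_mul, Matrix.mul_smul, smul_smul, sq]
  abel

theorem charpolyRev_coeff_zero (M : Matrix n n R) : M.charpolyRev.coeff 0 = 1 := by
  rw [coeff_zero_eq_eval_zero, eval_charpolyRev]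

theorem charpolyRev_smul (c : R) (M : Matrix n n R) :
    (c • M).charpolyRev = M.charpolyRev.comp (C c * X) := by
  rw [charpolyRev, charpolyRev, ← Polynomial.coe_compRingHom_apply, RingHom.map_det]
  congr 1
  refine Matrix.ext fun i j => ?_
  by_cases h : i = j <;> simp [h] <;> ring

theorem matrixE2_smul (c : R) (M : Matrix n n R) : matrixE2 (c • M) = c * c * matrixE2 M := by
  rw [matrixE2, charpolyRev_smul, comp_C_mul_X_coeff, matrixE2]
  ring

theorem two_mul_matrixE2 (M : Matrix n n R) :
    2 * matrixE2 M = M.trace ^ 2 - (M * M).trace := by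
  have h := congrArg (fun p => p.coeff 2) (charpolyRev_mul_charpolyRev_neg M)
  have h1 : (expand R 2 (M * M).charpolyRev).coeff 2 = - (M * M).trace := by
    rw [← coeff_charpolyRev_eq_neg_trace]
    simpa using coeff_expand_mul (p := 2) two_pos (M * M).charpolyRev 1
  have h2 : (-M).charpolyRev.coeff 2 = M.charpolyRev.coeff 2 := by
    rw [← neg_one_smul R M, charpolyRev_smul, comp_C_mul_X_coeff]; simp
  simp only [h1] at h
  rw [coeff_mul, Finset.Nat.sum_antidiagonal_eq_sum_range_succ_mk] at h
  simp [Finset.sum_range_succ, charpolyRev_coeff_zero, h2, trace_neg] at h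
  rw [matrixE2]
  linear_combination h

theorem trace_map_ringHom {n R S : Type*} [Fintype n] [CommRing R] [CommRing S]
    (M : Matrix n n R) (f : R →+* S) : (M.map f).trace = f M.trace := by
  simp [trace]

/-- Identities between matrices over `R` can be checked over a domain of characteristic zero. -/
theorem exists_map_mvPolynomial {n R : Type*} [CommRing R] (M : Matrix n n R) :
    ∃ M' : Matrix n n (MvPolynomial R ℤ),
      M'.map (MvPolynomial.aeval (id : R → R) : MvPolynomial R ℤ →ₐ[ℤ] R).toRingHom = M :=
  ⟨M.map MvPolynomial.X, by ext; simp⟩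

/-- Newton's identity gives this only after doubling. It is therefore proved over an integer
polynomial ring, where 2 cancels, and then specialised. -/
theorem matrixE2_add (M N : Matrix n n R) :
    matrixE2 (M + N) = matrixE2 M + matrixE2 N + (M.trace * N.trace - (M * N).trace) := by
  obtain ⟨M, rfl⟩ := exists_map_mvPolynomial M
  obtain ⟨N, rfl⟩ := exists_map_mvPolynomial N
  rw [← Matrix.map_add _ (map_add _), ← Matrix.map_mul]
  simp only [matrixE2_map, trace_map_ringHom]
  have key : matrixE2 (M + N) = matrixE2 M + matrixE2 N + (M.trace * N.trace - (M * N).trace) := by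
    apply mul_left_cancel₀ (two_ne_zero (α := MvPolynomial R ℤ))
    have h1 := two_mul_matrixE2 (M + N)
    have h2 := two_mul_matrixE2 M
    have h3 := two_mul_matrixE2 N
    simp only [add_mul, mul_add, trace_add] at h1
    rw [trace_mul_comm N M] at h1
    linear_combination h1 - h2 - h3
  simp [key]

theorem matrixE2_kronecker (M : Matrix n n R) (N : Matrix m m R) :
    matrixE2 (kroneckerMap (· * ·) M N) = M.trace ^ 2 * matrixE2 N + matrixE2 M * N.trace ^ 2
      - 2 * (matrixE2 M * matrixE2 N) := by
  obtain ⟨M, rfl⟩ := exists_map_mvPolynomial M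
  obtain ⟨N, rfl⟩ := exists_map_mvPolynomial N
  have hk : ∀ f : MvPolynomial R ℤ →+* R, kroneckerMap (· * ·) (M.map f) (N.map f) =
      (kroneckerMap (· * ·) M N).map f := by intro f; ext; simp
  rw [hk]
  simp only [matrixE2_map, trace_map_ringHom]
  have key : matrixE2 (kroneckerMap (· * ·) M N) = M.trace ^ 2 * matrixE2 N +
      matrixE2 M * N.trace ^ 2 - 2 * (matrixE2 M * matrixE2 N) := by
    apply mul_left_cancel₀ (two_ne_zero (α := MvPolynomial R ℤ))
    have h1 := two_mul_matrixE2 (kroneckerMap (· * ·) M N)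
    have h2 := two_mul_matrixE2 M
    have h3 := two_mul_matrixE2 N
    rw [← mul_kronecker_mul, trace_kronecker, trace_kronecker] at h1
    linear_combination h1 + (2 * matrixE2 N - N.trace ^ 2) * h2
      - (M * M).trace * h3
  simp [key]

theorem matrixE2_one : matrixE2 (1 : Matrix n n R) = ((Fintype.card n).choose 2 : ℕ) := by
  have h := two_mul_matrixE2 (1 : Matrix n n ℤ)
  have h' : (2 : ℤ) * ((Fintype.card n).choose 2 : ℕ) =
      (Fintype.card n : ℤ) ^ 2 - Fintype.card n := by
    rw [Nat.choose_two_right, ← Nat.cast_ofNat, ← Nat.cast_mul, Nat.two_mul_div_two_of_even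
      (Nat.even_mul_pred_self _)]
    rcases Fintype.card n with _ | k
    · simp
    · push_cast [Nat.add_sub_cancel]; ring
  rw [mul_one, trace_one, ← h'] at h
  have h2 : matrixE2 (1 : Matrix n n ℤ) = ((Fintype.card n).choose 2 : ℕ) := by omega
  have h3 := matrixE2_map (1 : Matrix n n ℤ) (Int.castRingHom R)
  rw [Matrix.map_one _ (map_zero _) (map_one _), h2] at h3
  simpa using h3

theorem trace_mul_self (M : Matrix n n R) : (M * M).trace = M.trace ^ 2 - 2 * matrixE2 M := by
  rw [two_mul_matrixE2]; ring

theorem charpoly_kronecker_one (M : Matrix n n R) :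
    (kroneckerMap (· * ·) M (1 : Matrix m m R)).charpoly = M.charpoly ^ Fintype.card m := by
  have h : (kroneckerMap (· * ·) M (1 : Matrix m m R)).charmatrix =
      kroneckerMap (· * ·) M.charmatrix (1 : Matrix m m R[X]) := by
    ext ⟨i, i'⟩ ⟨j, j'⟩ : 2
    by_cases h : i = j <;> by_cases h' : i' = j' <;>
      simp [h, h']
  rw [charpoly, h, det_kronecker, det_one, one_pow, mul_one, charpoly]

/-- Left multiplication acts on each column separately, so in the standard basis it is the Kronecker
product of `M` with the identity. -/
theorem charpoly_lmul_matrix (M : Matrix n n R) :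
    (Algebra.lmul R (Matrix n n R) M).charpoly = M.charpoly ^ Fintype.card n := by
  rw [← LinearMap.charpoly_toMatrix _ (Matrix.stdBasis R n n), ← charpoly_kronecker_one (m := n)]
  congr 1
  ext ⟨i, i'⟩ ⟨j, j'⟩
  rw [LinearMap.toMatrix_apply]
  rw [Matrix.stdBasis_eq_single]
  simp only [stdBasis, Module.Basis.map_repr, LinearEquiv.trans_apply, Algebra.coe_lmul_eq_mul,
    LinearMap.mul_apply']
  by_cases h : i' = j'
  · subst h; simp
  · simp [h, mul_single_apply_of_ne _ _ _ _ _ h]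

end SecondTrace

/-! ### Splitting by the separable closure -/

namespace SecondTrace

/-- The multiplication algebra of a central simple algebra is its full endomorphism algebra. -/
theorem subalgebra_end_eq_top {F A : Type*} [Field F] [Ring A] [Algebra F A]
    [FiniteDimensional F A] [Algebra.IsCentral F A] [IsSimpleRing A]
    (S : Subalgebra F (Module.End F A)) (hl : ∀ a, LinearMap.mulLeft F a ∈ S)
    (hr : ∀ a, LinearMap.mulRight F a ∈ S) : S = ⊤ := by
  -- An `S`-submodule of `A` is a two-sided ideal.
  have hsimple : IsSimpleModule S A := by
    rw [isSimpleModule_iff_toSpanSingleton_surjective]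
    refine ⟨inferInstance, fun x hx y => ?_⟩
    let J := Submodule.span S {x}
    let I : TwoSidedIdeal A := .mk' (J : Set A) (zero_mem _) (fun h h' => add_mem h h')
      (fun h => J.smul_mem ⟨-1, S.neg_mem S.one_mem⟩ h)
      (fun {a b} h => J.smul_mem ⟨_, hl a⟩ h) (fun {a b} h => J.smul_mem ⟨_, hr b⟩ h)
    have hmem (z : A) : z ∈ I ↔ z ∈ J := TwoSidedIdeal.mem_mk' ..
    have hI : (1 : A) ∈ I := IsSimpleRing.one_mem_of_ne_zero_mem I hx
      ((hmem x).2 (Submodule.mem_span_singleton_self x))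
    have hy : y ∈ I := by simpa using I.mul_mem_left y 1 hI
    exact Submodule.mem_span_singleton.1 ((hmem y).1 hy)
  rw [eq_top_iff]
  rintro T -
  -- Commuting with both multiplications forces `g` to be multiplication by the central element `g
  -- 1`.
  have hend (g : Module.End S A) : ∃ c : F, ∀ m, g m = c • m := by
    have hgl (a m : A) : g (a * m) = a * g m := g.map_smul (⟨_, hl a⟩ : S) m
    have hgr (a m : A) : g (m * a) = g m * a := g.map_smul (⟨_, hr a⟩ : S) m
    have hc : g 1 ∈ Subalgebra.center F A := by
      rw [Subalgebra.mem_center_iff]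
      intro b
      rw [← hgl, ← hgr, mul_one, one_mul]
    obtain ⟨c, hc⟩ := (Algebra.IsCentral.mem_center_iff F).1 hc
    exact ⟨c, fun m => by rw [← one_mul m, hgr, hc, one_mul, Algebra.smul_def]⟩
  let f : Module.End (Module.End S A) A :=
    { toFun := T
      map_add' := T.map_add
      map_smul' := fun g m => by
        obtain ⟨c, hc⟩ := hend g
        simp [hc] }
  obtain ⟨s, hs⟩ := Module.Finite.fg_top (R := F) (M := A)
  -- Density on a finite spanning set already gives equality everywhere.
  obtain ⟨r, hr⟩ := jacobson_density (R := S) f s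
  have : T = r := by
    refine LinearMap.ext_on hs fun m hm => hr m hm
  exact this ▸ r.2

/-- The `F`-endomorphisms of `A` whose base change preserves an ideal form a subalgebra containing
all multiplications, hence are all endomorphisms. A rank-one endomorphism, a coordinate times 1,
then sends a nonzero element of the ideal to a nonzero scalar. -/
theorem isSimpleRing_baseChange (F E A : Type*) [Field F] [Field E] [Algebra F E] [Ring A]
    [Algebra F A] [FiniteDimensional F A] [Algebra.IsCentral F A] [IsSimpleRing A] :
    IsSimpleRing (E ⊗[F] A) := by
  refine IsSimpleRing.of_eq_bot_or_eq_top fun I => or_iff_not_imp_left.2 fun hI => ?_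
  obtain ⟨x, hx, hx0⟩ : ∃ x ∈ I, x ≠ 0 := by
    by_contra! h
    exact hI (eq_bot_iff.2 fun x hx => by simpa using h x hx)
  let S : Subalgebra F (Module.End F A) :=
    { carrier := {T | ∀ y ∈ I, LinearMap.baseChange E T y ∈ I}
      mul_mem' := fun {T U} hT hU y hy => by
        rw [LinearMap.baseChange_mul]
        exact hT _ (hU _ hy)
      add_mem' := fun {T U} hT hU y hy => by
        rw [LinearMap.baseChange_add]
        exact I.add_mem (hT _ hy) (hU _ hy)
      algebraMap_mem' := fun c y hy => by
        have : LinearMap.baseChange E (algebraMap F (Module.End F A) c) y =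
            (algebraMap F (E ⊗[F] A) c) * y := by
          rw [Algebra.algebraMap_eq_smul_one, LinearMap.baseChange_smul, LinearMap.smul_apply,
            Module.End.one_eq_id, LinearMap.baseChange_id, LinearMap.id_apply, Algebra.smul_def]
        rw [this]
        exact I.mul_mem_left _ _ hy }
  have hS : S = ⊤ := subalgebra_end_eq_top S
    (fun a y hy => by
      have : LinearMap.baseChange E (LinearMap.mulLeft F a) y = (1 ⊗ₜ a) * y := by
        clear hy
        induction y with
        | zero => simp
        | tmul e b => simp
        | add y z hy hz => simp_all [mul_add]
      rw [this]
      exact I.mul_mem_left _ _ hy)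
    (fun a y hy => by
      have : LinearMap.baseChange E (LinearMap.mulRight F a) y = y * (1 ⊗ₜ a) := by
        clear hy
        induction y with
        | zero => simp
        | tmul e b => simp
        | add y z hy hz => simp_all [add_mul]
      rw [this]
      exact I.mul_mem_right _ _ hy)
  let b := Module.finBasis F A
  have hb : ∃ i, (b.baseChange E).repr x i ≠ 0 := by
    by_contra! h
    exact hx0 ((b.baseChange E).repr.map_eq_zero_iff.1 (Finsupp.ext h))
  obtain ⟨i, hi⟩ := hb
  have hT : (b.coord i).smulRight (1 : A) ∈ S := hS ▸ Algebra.mem_top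
  have h1 : LinearMap.baseChange E ((b.coord i).smulRight (1 : A)) x =
      algebraMap E _ ((b.baseChange E).repr x i) := by
    clear hi hx hx0
    induction x with
    | zero => simp
    | tmul e a =>
      simp [Algebra.TensorProduct.algebraMap_apply, Algebra.smul_def, mul_comm]
      rw [Algebra.algebraMap_eq_smul_one (A := A), ← TensorProduct.smul_tmul, Algebra.smul_def,
        mul_comm]
    | add y z hy hz => simp only [map_add, hy, hz, Finsupp.add_apply]
  have h2 := hT x hx
  rw [h1] at h2
  have h3 := I.mul_mem_left (algebraMap E _ ((b.baseChange E).repr x i)⁻¹) _ h2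
  rw [← map_mul, inv_mul_cancel₀ hi, map_one] at h3
  exact I.eq_top h3

theorem isCentral_baseChange (F E A : Type*) [Field F] [Field E] [Algebra F E] [Ring A]
    [Algebra F A] [Algebra.IsCentral F A] : Algebra.IsCentral E (E ⊗[F] A) := by
  refine ⟨fun z hz => ?_⟩
  rw [Subalgebra.mem_center_iff] at hz
  have h : z ∈ Subalgebra.centralizer F
      (Algebra.TensorProduct.includeRight : A →ₐ[F] E ⊗[F] A).range :=
    Subalgebra.mem_centralizer_iff _ |>.2 fun y _ => hz y
  rw [Subalgebra.centralizer_range_includeRight_eq_center_tensorProduct] at h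
  obtain ⟨w, rfl⟩ := h
  clear hz
  refine Algebra.mem_bot.2 ?_
  induction w with
  | zero => exact ⟨0, by simp⟩
  | tmul e a =>
    obtain ⟨c, hc⟩ := (Algebra.IsCentral.mem_center_iff F).1 a.2
    refine ⟨c • e, ?_⟩
    change _ = Algebra.TensorProduct.map (AlgHom.id F E) (Subalgebra.center F A).val (e ⊗ₜ a)
    rw [Algebra.TensorProduct.algebraMap_apply, Algebra.TensorProduct.map_tmul]
    simp [hc, Algebra.algebraMap_eq_smul_one, TensorProduct.smul_tmul]
  | add y z hy hz =>
    obtain ⟨c, hc⟩ := hy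
    obtain ⟨d, hd⟩ := hz
    exact ⟨c + d, by rw [map_add, hc, hd, map_add]⟩

theorem isCentral_of_matrix (E D : Type*) [Field E] [Ring D] [Algebra E D] (n : ℕ) [NeZero n]
    [Algebra.IsCentral E (Matrix (Fin n) (Fin n) D)] : Algebra.IsCentral E D := by
  refine ⟨fun z hz => ?_⟩
  rw [Subalgebra.mem_center_iff] at hz
  have h : Matrix.scalar (Fin n) z ∈ Subalgebra.center E (Matrix (Fin n) (Fin n) D) := by
    rw [Subalgebra.mem_center_iff]
    intro M
    ext i j
    simp [Matrix.scalar_apply, hz]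
  obtain ⟨c, hc⟩ := (Algebra.IsCentral.mem_center_iff E).1 h
  refine ⟨c, ?_⟩
  simpa [Matrix.scalar_apply, Matrix.algebraMap_matrix_apply] using (congr_fun₂ hc 0 0).symm

/-- By Jacobson–Noether a larger `D` would contain a noncentral separable element, whose minimal
polynomial over `E` would be linear. -/
theorem algebraMap_bijective_of_isSepClosed (E D : Type*) [Field E] [IsSepClosed E]
    [DivisionRing D] [Algebra E D] [FiniteDimensional E D] [Algebra.IsCentral E D] :
    Function.Bijective (algebraMap E D) := by
  refine ⟨(algebraMap E D).injective, fun y => ?_⟩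
  by_contra hy
  have hne : (⊥ : Subalgebra E D) ≠ ⊤ := fun h => hy (by
    have : y ∈ (⊥ : Subalgebra E D) := h ▸ Algebra.mem_top
    exact Algebra.mem_bot.1 this)
  obtain ⟨x, hx, hsep⟩ := JacobsonNoether.exists_separable_and_not_isCentral' hne
  have hint : IsIntegral E x := Algebra.IsIntegral.isIntegral x
  have hdeg := IsSepClosed.degree_eq_one_of_irreducible E (minpoly.irreducible hint) hsep
  exact hx (Algebra.mem_bot.2 (minpoly.mem_range_of_degree_eq_one E x hdeg))

/-- A central simple algebra is split by the separable closure of its center. -/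
theorem nonempty_splittingRep_separableClosure (F : Type u) (A : Type v) [Field F] [Ring A]
    [Algebra F A] [FiniteDimensional F A] [Algebra.IsCentral F A] [IsSimpleRing A] :
    degree F A ≠ 0 ∧ Nonempty (SplittingRep F A (SeparableClosure F)) := by
  let E := SeparableClosure F
  have := isSimpleRing_baseChange F E A
  have := isCentral_baseChange F E A
  have := IsArtinianRing.of_finite E (E ⊗[F] A)
  obtain ⟨n, hn, D, _, _, _, ⟨e⟩⟩ :=
    IsSimpleRing.exists_algEquiv_matrix_divisionRing_finite E (E ⊗[F] A)
  have := Algebra.IsCentral.of_algEquiv E _ _ e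
  have := isCentral_of_matrix E D n
  let e' : (E ⊗[F] A) ≃ₐ[E] Matrix (Fin n) (Fin n) E := e.trans <| .mapMatrix <| .symm <|
    .ofBijective (Algebra.ofId E D) (algebraMap_bijective_of_isSepClosed E D)
  have hdeg : degree F A = n := by
    have h := e'.toLinearEquiv.finrank_eq
    rw [Module.finrank_baseChange, Module.finrank_matrix] at h
    simp [degree, h]
  refine ⟨hdeg ▸ hn.out, ?_⟩
  rw [SplittingRep, hdeg]
  exact ⟨e'⟩

end SecondTrace

namespace SecondTrace
open Matrix Polynomial

/-! ### Descent of the reduced polynomial, the reduced trace and `t_2` -/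

section ReducedPoly

variable {F : Type u} {A : Type v} [Field F] [Ring A] [Algebra F A] [FiniteDimensional F A]

/-- The right-hand side involves neither `φ` nor a choice over `E`; independence of the splitting
and Galois invariance both follow from it. -/
theorem charpoly_pow_degree {E : Type w} [Field E] [Algebra F E] (φ : SplittingRep F A E) (a : A) :
    (φ (1 ⊗ₜ[F] a)).charpoly ^ degree F A =
      (Algebra.lmul F A a).charpoly.map (algebraMap F E) := by
  have h1 : (Algebra.lmul F A a).baseChange E = Algebra.lmul E (E ⊗[F] A) (1 ⊗ₜ a) := by
    ext; simp
  have h2 : Algebra.lmul E _ (φ (1 ⊗ₜ a)) =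
      φ.toLinearEquiv.conj (Algebra.lmul E (E ⊗[F] A) (1 ⊗ₜ a)) := by
    refine LinearMap.ext fun M => ?_
    simp [LinearEquiv.conj_apply]
  rw [← LinearMap.charpoly_baseChange, h1, ← φ.toLinearEquiv.charpoly_conj, ← h2,
    charpoly_lmul_matrix, Fintype.card_fin]

/-- Integral closedness of `K[X]` turns divisibility of powers into divisibility, even if the
characteristic divides `n`. -/
theorem monic_pow_left_injective {K : Type*} [Field K] {p q : K[X]} (hp : p.Monic) (hq : q.Monic)
    {n : ℕ} (hn : n ≠ 0) (h : p ^ n = q ^ n) : p = q :=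
  eq_of_monic_of_associated hp hq (associated_of_dvd_dvd
    ((IsIntegrallyClosed.pow_dvd_pow_iff hn).1 h.dvd)
    ((IsIntegrallyClosed.pow_dvd_pow_iff hn).1 h.symm.dvd))

omit [FiniteDimensional F A] in
theorem IsReducedPoly.monic {a : A} {p : F[X]} (h : IsReducedPoly F a p) : p.Monic := by
  obtain ⟨E, _, _, φ, h⟩ := h
  exact monic_of_injective (algebraMap F E).injective (h ▸ charpoly_monic _)

theorem IsReducedPoly.pow_degree {a : A} {p : F[X]} (h : IsReducedPoly F a p) :
    p ^ degree F A = (Algebra.lmul F A a).charpoly := by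
  obtain ⟨E, _, _, φ, h⟩ := h
  apply map_injective _ (algebraMap F E).injective
  rw [Polynomial.map_pow, h, charpoly_pow_degree]

variable {E : Type u} [Field E] [Algebra F E] [IsGalois F E]

theorem exists_map_eq_charpoly (hdeg : degree F A ≠ 0) (φ : SplittingRep F A E) (a : A) :
    ∃ p : F[X], p.map (algebraMap F E) = (φ (1 ⊗ₜ[F] a)).charpoly := by
  refine (mem_lifts _).1 ((lifts_iff_coeff_lifts _).2 fun k => ?_)
  rw [InfiniteGalois.mem_range_algebraMap_iff_fixed]
  intro σ
  have h : (φ (1 ⊗ₜ[F] a)).charpoly.map (σ : E →+* E) = (φ (1 ⊗ₜ[F] a)).charpoly := by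
    -- A Galois conjugate is a monic root, of the same order, of the same polynomial over `F`.
    refine monic_pow_left_injective ((charpoly_monic _).map _) (charpoly_monic _) hdeg ?_
    rw [← Polynomial.map_pow, charpoly_pow_degree, Polynomial.map_map]
    congr 1
    ext x
    simp
  have h' := congrArg (fun p => p.coeff k) h
  simpa using h'

/-- Over a Galois splitting field, the reduced polynomial becomes the characteristic polynomial. -/
theorem map_reducedPoly (hdeg : degree F A ≠ 0) (φ : SplittingRep F A E) (a : A) :
    (reducedPoly F a).map (algebraMap F E) = (φ (1 ⊗ₜ[F] a)).charpoly := by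
  obtain ⟨p, hp⟩ := exists_map_eq_charpoly hdeg φ a
  have hp' : IsReducedPoly F a p := ⟨E, _, _, φ, hp⟩
  have hr : IsReducedPoly F a (reducedPoly F a) := Classical.epsilon_spec ⟨p, hp'⟩
  rw [← hp, monic_pow_left_injective hr.monic hp'.monic hdeg (hr.pow_degree.trans hp'.pow_degree.symm)]

theorem algebraMap_t (hdeg : degree F A ≠ 0) (φ : SplittingRep F A E) (k : ℕ) (a : A) :
    algebraMap F E (t F k a) = (-1) ^ k * (φ (1 ⊗ₜ[F] a)).charpolyRev.coeff k := by
  rw [← reverse_charpoly, coeff_reverse, charpoly_natDegree_eq_dim, Fintype.card_fin, t]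
  split_ifs with h
  · rw [revAt_le h, map_mul, map_pow, map_neg, map_one, ← coeff_map, map_reducedPoly hdeg φ]
  -- Beyond the degree, `revAt` is the identity and the coefficient vanishes, matching the
  -- convention for `t`.
  · rw [revAt_eq_self_of_lt (not_le.1 h), coeff_eq_zero_of_natDegree_lt, mul_zero, map_zero]
    rw [charpoly_natDegree_eq_dim, Fintype.card_fin]
    exact not_le.1 h

theorem algebraMap_t_one (hdeg : degree F A ≠ 0) (φ : SplittingRep F A E) (a : A) :
    algebraMap F E (t F 1 a) = (φ (1 ⊗ₜ[F] a)).trace := by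
  simp [algebraMap_t hdeg φ]

theorem algebraMap_t_two (hdeg : degree F A ≠ 0) (φ : SplittingRep F A E) (a : A) :
    algebraMap F E (t F 2 a) = matrixE2 (φ (1 ⊗ₜ[F] a)) := by
  simp [algebraMap_t hdeg φ, matrixE2]

omit [FiniteDimensional F A] [IsGalois F E] in
theorem SplittingRep.map_smul (φ : SplittingRep F A E) (c : F) (a : A) :
    φ (1 ⊗ₜ[F] (c • a)) = algebraMap F E c • φ (1 ⊗ₜ[F] a) := by
  rw [← _root_.map_smul, TensorProduct.smul_tmul', smul_eq_mul, mul_one,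
    ← TensorProduct.smul_tmul, Algebra.algebraMap_eq_smul_one]

theorem reducedTrace_apply (hdeg : degree F A ≠ 0) (φ : SplittingRep F A E) (a : A) :
    reducedTrace F A a = t F 1 a := by
  refine Classical.epsilon_spec (p := fun f : A →ₗ[F] F => ∀ a, f a = t F 1 a)
    ⟨{ toFun := t F 1, map_add' := fun a b => ?_, map_smul' := fun c a => ?_ }, fun _ => rfl⟩ a
  all_goals apply (algebraMap F E).injective
  · simp [algebraMap_t_one hdeg φ, TensorProduct.tmul_add]
  · rw [algebraMap_t_one hdeg φ, SplittingRep.map_smul, trace_smul, RingHom.id_apply, smul_eq_mul,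
      smul_eq_mul, map_mul, algebraMap_t_one hdeg φ]

theorem algebraMap_reducedTrace (hdeg : degree F A ≠ 0) (φ : SplittingRep F A E) (a : A) :
    algebraMap F E (reducedTrace F A a) = (φ (1 ⊗ₜ[F] a)).trace := by
  rw [reducedTrace_apply hdeg φ, algebraMap_t_one hdeg φ]

theorem t_two_add (hdeg : degree F A ≠ 0) (φ : SplittingRep F A E) (a b : A) :
    t F 2 (a + b) = t F 2 a + t F 2 b +
      (reducedTrace F A a * reducedTrace F A b - reducedTrace F A (a * b)) := by
  apply (algebraMap F E).injective
  have : (1 : E) ⊗ₜ[F] (a * b) = (1 ⊗ₜ a) * (1 ⊗ₜ b) := by simp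
  simp only [map_add, map_sub, map_mul, algebraMap_t_two hdeg φ, algebraMap_reducedTrace hdeg φ,
    TensorProduct.tmul_add, matrixE2_add, this]

theorem t_two_smul (hdeg : degree F A ≠ 0) (φ : SplittingRep F A E) (c : F) (a : A) :
    t F 2 (c • a) = c * c * t F 2 a := by
  apply (algebraMap F E).injective
  rw [algebraMap_t_two hdeg φ, SplittingRep.map_smul φ, matrixE2_smul, map_mul, map_mul, algebraMap_t_two hdeg φ]

theorem t2Form_apply (hdeg : degree F A ≠ 0) (φ : SplittingRep F A E) (a : A) :
    t2Form F A a = t F 2 a := by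
  have hpolar (x y : A) : QuadraticMap.polar (t F 2) x y =
      reducedTrace F A x * reducedTrace F A y - reducedTrace F A (x * y) := by
    rw [QuadraticMap.polar, t_two_add hdeg φ]; ring
  refine Classical.epsilon_spec (p := fun Q : QuadraticForm F A => ∀ a, Q a = t F 2 a)
    ⟨QuadraticMap.ofPolar (t F 2) (t_two_smul hdeg φ) (fun x x' y => ?_) (fun c x y => ?_),
      fun _ => rfl⟩ a
  · simp only [hpolar, map_add, add_mul]; ring
  · simp only [hpolar, map_smul, smul_mul_assoc, smul_eq_mul]; ring

theorem algebraMap_t2Form (hdeg : degree F A ≠ 0) (φ : SplittingRep F A E) (a : A) :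
    algebraMap F E (t2Form F A a) = matrixE2 (φ (1 ⊗ₜ[F] a)) := by
  rw [t2Form_apply hdeg φ, algebraMap_t_two hdeg φ]

theorem polar_t2Form (hdeg : degree F A ≠ 0) (φ : SplittingRep F A E) (x y : A) :
    QuadraticMap.polar (t2Form F A) x y =
      reducedTrace F A x * reducedTrace F A y - reducedTrace F A (x * y) := by
  rw [QuadraticMap.polar, t2Form_apply hdeg φ, t2Form_apply hdeg φ, t2Form_apply hdeg φ,
    t_two_add hdeg φ]
  ring

theorem reducedTrace_mul_comm (hdeg : degree F A ≠ 0) (φ : SplittingRep F A E) (x y : A) :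
    reducedTrace F A (x * y) = reducedTrace F A (y * x) := by
  apply (algebraMap F E).injective
  have (x y : A) : (1 : E) ⊗ₜ[F] (x * y) = (1 ⊗ₜ x) * (1 ⊗ₜ y) := by simp
  simp only [algebraMap_reducedTrace hdeg φ, this, map_mul, trace_mul_comm (φ (1 ⊗ₜ x))]

theorem reducedTrace_one (hdeg : degree F A ≠ 0) (φ : SplittingRep F A E) :
    reducedTrace F A 1 = degree F A := by
  apply (algebraMap F E).injective
  simp [algebraMap_reducedTrace hdeg φ, ← Algebra.TensorProduct.one_def]

theorem t2Form_one (hdeg : degree F A ≠ 0) (φ : SplittingRep F A E) :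
    t2Form F A 1 = ((degree F A).choose 2 : ℕ) := by
  apply (algebraMap F E).injective
  simp [algebraMap_t2Form hdeg φ, ← Algebra.TensorProduct.one_def, matrixE2_one]

theorem reducedTrace_mul_self (hdeg : degree F A ≠ 0) (φ : SplittingRep F A E) (x : A) :
    reducedTrace F A (x * x) = reducedTrace F A x ^ 2 - 2 * t2Form F A x := by
  apply (algebraMap F E).injective
  have : (1 : E) ⊗ₜ[F] (x * x) = (1 ⊗ₜ x) * (1 ⊗ₜ x) := by simp
  simp only [algebraMap_reducedTrace hdeg φ, algebraMap_t2Form hdeg φ, this, map_mul, map_sub,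
    map_pow, map_ofNat, trace_mul_self]

/-- The vanishing extends linearly to `E`, where the trace pairing of matrices is nondegenerate. -/
theorem reducedTrace_nondegenerate (hdeg : degree F A ≠ 0) (φ : SplittingRep F A E) (x : A)
    (hx : ∀ y, reducedTrace F A (x * y) = 0) : x = 0 := by
  have h (z : E ⊗[F] A) : (φ (1 ⊗ₜ x) * φ z).trace = 0 := by
    induction z with
    | zero => simp
    | tmul e y =>
      have : (1 ⊗ₜ[F] x) * (e ⊗ₜ[F] y) = e • ((1 : E) ⊗ₜ[F] (x * y)) := by
        simp [TensorProduct.smul_tmul']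
      rw [← map_mul, this, map_smul, trace_smul, ← algebraMap_reducedTrace hdeg φ, hx, map_zero,
        smul_zero]
    | add y z hy hz => rw [map_add, mul_add, trace_add, hy, hz, add_zero]
  have h0 : φ (1 ⊗ₜ x) = 0 := by
    rw [ext_iff_trace_mul_right]
    intro M
    rw [← φ.apply_symm_apply M, h, zero_mul, trace_zero]
  have h1 : (1 : E) ⊗ₜ[F] x = 0 := by simpa using h0
  exact Algebra.TensorProduct.includeRight_injective (algebraMap F E).injective
    (h1.trans (map_zero (Algebra.TensorProduct.includeRight : A →ₐ[F] E ⊗[F] A)).symm)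

omit [IsGalois F E] in
theorem finrank_eq_degree_sq (φ : SplittingRep F A E) :
    Module.finrank F A = degree F A ^ 2 := by
  have h := φ.toLinearEquiv.finrank_eq
  rw [Module.finrank_baseChange, Module.finrank_matrix] at h
  simp [h, sq]

end ReducedPoly

/-! ### Trace and `t_2` on pure tensors, through Kronecker products -/

section Tensor

variable {F : Type u} {A : Type v} [Field F] [Ring A] [Algebra F A]
  {E : Type u} [Field E] [Algebra F E]

theorem degree_tensor (h : Module.finrank F A = degree F A ^ 2) :
    degree F (A ⊗[F] A) = degree F A ^ 2 := by
  rw [degree, Module.finrank_tensorProduct, h, Nat.sqrt_eq]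

/-- Scalar extension of a tensor product of algebras. -/
noncomputable def tensorBaseChange (F : Type u) (A : Type v) (E : Type u) [Field F] [Ring A]
    [Algebra F A] [Field E] [Algebra F E] :
    E ⊗[F] (A ⊗[F] A) ≃ₐ[E] (E ⊗[F] A) ⊗[E] (E ⊗[F] A) :=
  Algebra.TensorProduct.algEquivOfLinearEquivTensorProduct
    (TensorProduct.AlgebraTensorModule.distribBaseChange F E A A)
    (fun e e' x y => by
      induction x with
      | zero => simp
      | add x x' hx hx' => simp only [add_mul, TensorProduct.tmul_add, map_add, hx, hx']
      | tmul a b =>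
        induction y with
        | zero => simp
        | add y y' hy hy' => simp only [mul_add, TensorProduct.tmul_add, map_add, hy, hy']
        | tmul c d => simp [TensorProduct.AlgebraTensorModule.distribBaseChange_tmul])
    (by simp [Algebra.TensorProduct.one_def,
      TensorProduct.AlgebraTensorModule.distribBaseChange_tmul])

theorem exists_splittingRep_tensor (h : Module.finrank F A = degree F A ^ 2)
    (φ : SplittingRep F A E) :
    ∃ (ψ : SplittingRep F (A ⊗[F] A) E)
      (e : Fin (degree F A) × Fin (degree F A) ≃ Fin (degree F (A ⊗[F] A))),
      ∀ a b, ψ (1 ⊗ₜ (a ⊗ₜ b)) =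
        reindex e e (kroneckerMap (· * ·) (φ (1 ⊗ₜ a)) (φ (1 ⊗ₜ b))) := by
  let e : Fin (degree F A) × Fin (degree F A) ≃ Fin (degree F (A ⊗[F] A)) :=
    finProdFinEquiv.trans (finCongr (by rw [degree_tensor h, sq]))
  refine ⟨(tensorBaseChange F A E).trans <| (Algebra.TensorProduct.congr φ φ).trans <|
    (kroneckerAlgEquiv _ _ E).trans (reindexAlgEquiv E E e), e, fun a b => ?_⟩
  simp [tensorBaseChange]
  rfl

theorem matrixE2_reindex {n m R : Type*} [Fintype n] [DecidableEq n] [Fintype m] [DecidableEq m]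
    [CommRing R] (e : n ≃ m) (M : Matrix n n R) : matrixE2 (reindex e e M) = matrixE2 M := by
  rw [matrixE2, matrixE2, ← reverse_charpoly, charpoly_reindex, reverse_charpoly]

theorem trace_reindex' {n m R : Type*} [Fintype n] [Fintype m] [CommRing R] (e : n ≃ m)
    (M : Matrix n n R) : (reindex e e M).trace = M.trace :=
  e.symm.sum_comp fun i => M i i

variable [FiniteDimensional F A] [IsGalois F E]

omit [IsGalois F E] in
theorem degree_tensor_ne_zero (hdeg : degree F A ≠ 0) (φ : SplittingRep F A E) :
    degree F (A ⊗[F] A) ≠ 0 := by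
  rw [degree_tensor (finrank_eq_degree_sq φ)]
  exact pow_ne_zero _ hdeg

theorem reducedTrace_tmul (hdeg : degree F A ≠ 0) (φ : SplittingRep F A E) (a b : A) :
    reducedTrace F (A ⊗[F] A) (a ⊗ₜ b) = reducedTrace F A a * reducedTrace F A b := by
  obtain ⟨ψ, e, h⟩ := exists_splittingRep_tensor (finrank_eq_degree_sq φ) φ
  apply (algebraMap F E).injective
  rw [algebraMap_reducedTrace (degree_tensor_ne_zero hdeg φ) ψ, map_mul,
    algebraMap_reducedTrace hdeg φ, algebraMap_reducedTrace hdeg φ, h, trace_reindex',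
    trace_kronecker]

theorem t2Form_tmul (hdeg : degree F A ≠ 0) (φ : SplittingRep F A E) (a b : A) :
    t2Form F (A ⊗[F] A) (a ⊗ₜ b) = reducedTrace F A a ^ 2 * t2Form F A b +
      t2Form F A a * reducedTrace F A b ^ 2 - 2 * (t2Form F A a * t2Form F A b) := by
  obtain ⟨ψ, e, h⟩ := exists_splittingRep_tensor (finrank_eq_degree_sq φ) φ
  apply (algebraMap F E).injective
  simp only [map_sub, map_add, map_mul, map_pow, map_ofNat, algebraMap_reducedTrace hdeg φ,
    algebraMap_t2Form hdeg φ, algebraMap_t2Form (degree_tensor_ne_zero hdeg φ) ψ, h,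
    matrixE2_reindex, matrixE2_kronecker]

end Tensor

end SecondTrace

namespace SecondTrace

/-! ### Recognising hyperbolic summands -/

section Hyperbolic
open QuadraticMap

variable {F : Type u} {V : Type v} [Field F] [AddCommGroup V] [Module F V] {ι : Type*} [Fintype ι]

omit [Fintype ι] in
theorem polar_finset_sum_right (Q : QuadraticForm F V) (s : Finset ι) (f : ι → V) (y : V) :
    polar Q y (∑ i ∈ s, f i) = ∑ i ∈ s, polar Q y (f i) :=
  map_sum (Q.polarBilin y) f s

theorem polar_sum_right (Q : QuadraticForm F V) (f : ι → V) (y : V) :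
    polar Q y (∑ i, f i) = ∑ i, polar Q y (f i) :=
  polar_finset_sum_right Q _ f y

theorem polar_sum_left (Q : QuadraticForm F V) (f : ι → V) (y : V) :
    polar Q (∑ i, f i) y = ∑ i, polar Q (f i) y := by
  simp only [polar_comm Q _ y, polar_sum_right]

theorem map_sum_smul_eq_zero (Q : QuadraticForm F V) (u : ι → V) (hu : ∀ i, Q (u i) = 0)
    (huu : ∀ i j, polar Q (u i) (u j) = 0) (c : ι → F) : Q (∑ i, c i • u i) = 0 := by
  classical
  have key (s : Finset ι) : Q (∑ i ∈ s, c i • u i) = 0 := by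
    induction s using Finset.induction_on with
    | empty => simp
    | insert a s ha ih =>
      have hp : polar Q (c a • u a) (∑ i ∈ s, c i • u i) = 0 := by
        simp [polar_finset_sum_right, polar_smul_left, polar_smul_right, huu]
      rw [Finset.sum_insert ha, QuadraticMap.map_add Q, ih, hp, QuadraticMap.map_smul, hu]
      simp
  exact key _

theorem binaryForm_apply (a b : F) (p : F × F) :
    binaryForm a b p = a * (p.1 * p.1) + p.1 * p.2 + b * (p.2 * p.2) := by
  simp [binaryForm]

theorem hyperbolicSpace_apply (m : ℕ) (w : Fin m → F × F) :
    hyperbolicSpace F m w = ∑ i, (w i).1 * (w i).2 := by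
  simp [hyperbolicSpace, hyperbolicPlane, binaryForm_apply]

/-- A totally singular family with a dual family can be given a totally singular dual family. -/
theorem exists_isotropic_dual {m : ℕ} (Q : QuadraticForm F V) (u v : Fin m → V)
    (hu : ∀ i, Q (u i) = 0) (huu : ∀ i j, polar Q (u i) (u j) = 0)
    (huv : ∀ i j, polar Q (u i) (v j) = if i = j then 1 else 0) :
    ∃ c : Fin m → Fin m → F,
      (∀ i, Q (v i - ∑ k, c i k • u k) = 0) ∧
      ∀ i j, polar Q (v i - ∑ k, c i k • u k) (v j - ∑ k, c j k • u k) = 0 := by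
  -- Halving the Gram matrix of `v` is impossible in characteristic 2. A triangular choice has `c i
  -- i = Q (v i)` and, for distinct indices, `c i j + c j i = polar Q (v i) (v j)`, which is all
  -- that is needed.
  let c (i j : Fin m) : F :=
    if i = j then Q (v i) else if i < j then polar Q (v i) (v j) else 0
  have hvu (i j) : polar Q (v i) (u j) = if i = j then 1 else 0 := by
    rw [polar_comm, huv]; simp [eq_comm]
  refine ⟨c, fun i => ?_, fun i j => ?_⟩
  · rw [sub_eq_add_neg, QuadraticMap.map_add Q, QuadraticMap.map_neg, polar_neg_right,
      map_sum_smul_eq_zero Q u hu huu, polar_sum_right]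
    simp only [polar_smul_right, hvu]
    simp [c]
  · simp only [polar_sub_left, polar_sub_right, polar_sum_left, polar_sum_right, polar_smul_left,
      polar_smul_right, huu, hvu, huv]
    rcases lt_trichotomy i j with h | h | h
    · simp [c, h, h.ne, h.ne', h.not_gt]
    · subst h
      simp [c, polar_self]
      ring
    · simp [c, h, h.ne, h.ne', h.not_gt, polar_comm Q (v i)]

/-- The linear map from the sum of a plane and `m` planes given by two vectors and two families. -/
def planesMap {m : ℕ} (x y : V) (u v : Fin m → V) : (F × F) × (Fin m → F × F) →ₗ[F] V where
  toFun z := z.1.1 • x + z.1.2 • y + (∑ i, (z.2 i).1 • u i + ∑ i, (z.2 i).2 • v i)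
  map_add' z w := by
    simp only [Prod.fst_add, Prod.snd_add, Pi.add_apply, add_smul, Finset.sum_add_distrib]
    abel
  map_smul' c z := by
    simp only [Prod.smul_fst, Prod.smul_snd, Pi.smul_apply, smul_eq_mul, mul_smul, smul_add,
      Finset.smul_sum, RingHom.id_apply]

/-- A quadratic space spanned by dual totally singular families, and a binary form orthogonal to
both. -/
theorem equivalent_of_dual_isotropic [CharP F 2] [FiniteDimensional F V] {m : ℕ}
    (Q : QuadraticForm F V) (u v : Fin m → V) (x y : V)
    (hu : ∀ i, Q (u i) = 0) (huu : ∀ i j, polar Q (u i) (u j) = 0)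
    (hv : ∀ i, Q (v i) = 0) (hvv : ∀ i j, polar Q (v i) (v j) = 0)
    (huv : ∀ i j, polar Q (u i) (v j) = if i = j then 1 else 0)
    (hxy : polar Q x y = 1)
    (hux : ∀ i, polar Q (u i) x = 0) (hvx : ∀ i, polar Q (v i) x = 0)
    (huy : ∀ i, polar Q (u i) y = 0) (hvy : ∀ i, polar Q (v i) y = 0)
    (hdim : Module.finrank F V = 2 * m + 2) :
    Q.Equivalent ((binaryForm (Q x) (Q y)).prod (hyperbolicSpace F m)) := by
  have hyx : polar Q y x = 1 := by rw [polar_comm, hxy]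
  have hvu (i j) : polar Q (v i) (u j) = if i = j then 1 else 0 := by
    rw [polar_comm, huv]; simp [eq_comm]
  have hxu (i) : polar Q x (u i) = 0 := by rw [polar_comm, hux]
  have hxv (i) : polar Q x (v i) = 0 := by rw [polar_comm, hvx]
  have hyu (i) : polar Q y (u i) = 0 := by rw [polar_comm, huy]
  have hyv (i) : polar Q y (v i) = 0 := by rw [polar_comm, hvy]
  have h2 : (2 : F) = 0 := CharTwo.two_eq_zero
  have hself (z : V) : polar Q z z = 0 := by rw [polar_self, two_smul, CharTwo.add_self_eq_zero]
  let L := planesMap (F := F) x y u v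
  have hL (z) : L z = z.1.1 • x + z.1.2 • y + (∑ i, (z.2 i).1 • u i + ∑ i, (z.2 i).2 • v i) := rfl
  -- Pairing with `x`, `y`, `u`, `v` recovers each coordinate.
  have hinj : Function.Injective L := by
    rw [← LinearMap.ker_eq_bot, LinearMap.ker_eq_bot']
    intro z hz
    have h (w : V) : polar Q (L z) w = 0 := by rw [hz, polar_zero_left]
    simp only [hL, polar_add_left, polar_sum_left, polar_smul_left] at h
    have h1 := h x
    have h2 := h y
    have h3 i := h (u i)
    have h4 i := h (v i)
    simp [hself, hxy, hyx, hux, hvx, huy, hvy] at h1 h2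
    simp [huu, hvu, hxu, hyu] at h3
    simp [hvv, huv, hxv, hyv] at h4
    refine Prod.ext (Prod.ext h2 h1) (funext fun i => Prod.ext (h4 i) (h3 i))
  have hfin : Module.finrank F ((F × F) × (Fin m → F × F)) = Module.finrank F V := by
    rw [hdim, Module.finrank_prod, Module.finrank_pi_fintype]
    simp [Module.finrank_prod]
    ring
  let e := LinearEquiv.ofInjectiveOfFinrankEq L hinj hfin
  refine Equivalent.symm ⟨⟨e, fun z => ?_⟩⟩
  change Q (L z) = _
  rw [hL, QuadraticMap.map_add Q, QuadraticMap.map_add Q, QuadraticMap.map_add Q,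
    map_sum_smul_eq_zero Q u hu huu, map_sum_smul_eq_zero Q v hv hvv, prod_apply,
    hyperbolicSpace_apply, binaryForm_apply]
  simp only [polar_add_left, polar_add_right, polar_sum_left, polar_sum_right, polar_smul_left,
    polar_smul_right, hxy, hxu, hxv, hyu, hyv, huv, QuadraticMap.map_smul]
  simp
  rw [Finset.sum_congr rfl fun i _ => mul_comm (z.2 i).2 (z.2 i).1]
  ring

/-- A quadratic space spanned by a totally singular family, a dual family, and a binary form
orthogonal to both. -/
theorem equivalent_of_isotropic_family [CharP F 2] [FiniteDimensional F V] [DecidableEq ι]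
    (Q : QuadraticForm F V) (u v : ι → V) (x y : V)
    (hu : ∀ i, Q (u i) = 0) (huu : ∀ i j, polar Q (u i) (u j) = 0)
    (huv : ∀ i j, polar Q (u i) (v j) = if i = j then 1 else 0)
    (hxy : polar Q x y = 1)
    (hux : ∀ i, polar Q (u i) x = 0) (hvx : ∀ i, polar Q (v i) x = 0)
    (huy : ∀ i, polar Q (u i) y = 0) (hvy : ∀ i, polar Q (v i) y = 0)
    (hdim : Module.finrank F V = 2 * Fintype.card ι + 2) :
    Q.Equivalent ((binaryForm (Q x) (Q y)).prod (hyperbolicSpace F (Fintype.card ι))) := by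
  let e := (Fintype.equivFin ι).symm
  have huv' (i j) : polar Q (u (e i)) (v (e j)) = if i = j then 1 else 0 := by simp [huv]
  obtain ⟨c, hc, hc'⟩ := exists_isotropic_dual Q (u ∘ e) (v ∘ e) (fun i => hu _)
    (fun i j => huu _ _) huv'
  refine equivalent_of_dual_isotropic Q (u ∘ e) _ x y (fun i => hu _) (fun i j => huu _ _) hc hc'
    (fun i j => ?_) hxy (fun i => hux _) (fun i => ?_) (fun i => huy _) (fun i => ?_) hdim
  · simp [polar_sub_right, polar_sum_right, polar_smul_right, huu, huv]
  · simp [polar_sub_left, polar_sum_left, polar_smul_left, hux, hvx]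
  · simp [polar_sub_left, polar_sum_left, polar_smul_left, huy, hvy]

end Hyperbolic

/-! ### Symplectic bases -/

section Symplectic

/-- A nondegenerate alternating form has a symplectic basis. -/
theorem exists_symplectic_family {F : Type u} [Field F] (d : ℕ) :
    ∀ {V : Type v} [AddCommGroup V] [Module F V] [FiniteDimensional F V]
      (β : LinearMap.BilinForm F V), β.IsAlt → (∀ x, (∀ y, β x y = 0) → x = 0) →
      Module.finrank F V = d →
      ∃ (m : ℕ) (e f : Fin m → V), d = 2 * m ∧ (∀ i j, β (e i) (e j) = 0) ∧
        (∀ i j, β (f i) (f j) = 0) ∧ ∀ i j, β (e i) (f j) = if i = j then 1 else 0 := by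
  induction d using Nat.strong_induction_on with
  | _ d ih =>
  intro V _ _ _ β halt hnd hd
  rcases Nat.eq_zero_or_pos d with rfl | hpos
  · exact ⟨0, Fin.elim0, Fin.elim0, rfl, fun i => i.elim0, fun i => i.elim0, fun i => i.elim0⟩
  have : Nontrivial V := Module.nontrivial_of_finrank_pos (R := F) (hd ▸ hpos)
  obtain ⟨x, hx⟩ := exists_ne (0 : V)
  obtain ⟨y, hy⟩ : ∃ y, β x y = 1 := by
    by_contra! h
    refine hx (hnd x fun y => ?_)
    by_contra hxy
    exact h ((β x y)⁻¹ • y) (by simp [hxy])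
  have hyx : β y x = -1 := by rw [← halt.neg_eq, hy]
  let g : V →ₗ[F] F × F := (β x).prod (β y)
  have hg : LinearMap.range g = ⊤ := by
    rw [LinearMap.range_eq_top]
    intro p
    refine ⟨p.1 • y - p.2 • x, ?_⟩
    simp [g, hy, hyx, halt.self_eq_zero]
  let W := LinearMap.ker g
  have hW (w : W) : β x w = 0 ∧ β y w = 0 := by
    have := w.2
    simpa [W, g] using this
  have hW' (w : W) : β w x = 0 ∧ β w y = 0 := by
    rw [← halt.neg_eq, ← halt.neg_eq y, (hW w).1, (hW w).2]; simp
  have hdimW : Module.finrank F W = d - 2 ∧ 2 ≤ d := by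
    have h := LinearMap.finrank_range_add_finrank_ker g
    rw [hg, finrank_top, Module.finrank_prod, Module.finrank_self, hd] at h
    change _ + Module.finrank F W = d at h
    omega
  obtain ⟨m, e, f, hm, hee, hff, hef⟩ := ih (d - 2) (by omega) (β.restrict W)
    (fun w => halt w) (fun w hw => by
      apply Subtype.ext
      refine hnd w fun z => ?_
      -- Removing the component in the plane of `x` and `y` does not change the pairing with `w`, so
      -- nondegeneracy passes to `W`.
      have hz : z - (β x z • y - β y z • x) ∈ W := by
        simp [W, g, hy, hyx, halt.self_eq_zero]
      have h := hw ⟨_, hz⟩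
      simpa [(hW' w).1, (hW' w).2] using h) hdimW.1
  refine ⟨m + 1, Fin.cons x fun i => e i, Fin.cons y fun i => f i, by omega, ?_, ?_, ?_⟩
  · intro i j
    refine Fin.cases ?_ (fun i => ?_) i <;> refine Fin.cases ?_ (fun j => ?_) j
    · simp [halt.self_eq_zero]
    · simp [(hW _).1]
    · simp [(hW' _).1]
    · simpa using hee i j
  · intro i j
    refine Fin.cases ?_ (fun i => ?_) i <;> refine Fin.cases ?_ (fun j => ?_) j
    · simp [halt.self_eq_zero]
    · simp [(hW _).2]
    · simp [(hW' _).2]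
    · simpa using hff i j
  · intro i j
    refine Fin.cases ?_ (fun i => ?_) i <;> refine Fin.cases ?_ (fun j => ?_) j
    · simp [hy]
    · simp [(hW _).1, (Fin.succ_ne_zero j).symm]
    · simp [(hW' _).2]
    · simpa using hef i j

end Symplectic

end SecondTrace

namespace SecondTrace
open QuadraticMap

/-! ### Witt classes from totally singular families -/

section Witt

variable {F : Type u} {V : Type v} [Field F] [AddCommGroup V] [Module F V] {ι : Type*} [Fintype ι]
  [DecidableEq ι] [CharP F 2] [FiniteDimensional F V]

theorem wittEquivalent_binaryForm_of_isotropic_family (Q : QuadraticForm F V) (S : Submodule F V)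
    (u v : ι → V) (x y : V) (huS : ∀ i, u i ∈ S) (hvS : ∀ i, v i ∈ S) (hxS : x ∈ S) (hyS : y ∈ S)
    (hu : ∀ i, Q (u i) = 0) (huu : ∀ i j, polar Q (u i) (u j) = 0)
    (huv : ∀ i j, polar Q (u i) (v j) = if i = j then 1 else 0)
    (hxy : polar Q x y = 1)
    (hux : ∀ i, polar Q (u i) x = 0) (hvx : ∀ i, polar Q (v i) x = 0)
    (huy : ∀ i, polar Q (u i) y = 0) (hvy : ∀ i, polar Q (v i) y = 0)
    (hdim : Module.finrank F S = 2 * Fintype.card ι + 2) :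
    WittEquivalent (Q.comp S.subtype) (binaryForm (Q x) (Q y)) := by
  refine ⟨0, Fintype.card ι, Equivalent.trans ⟨⟨LinearEquiv.prodUnique, fun z => ?_⟩⟩
    (equivalent_of_isotropic_family (Q.comp S.subtype) (fun i => ⟨u i, huS i⟩)
      (fun i => ⟨v i, hvS i⟩) ⟨x, hxS⟩ ⟨y, hyS⟩ hu huu huv hxy hux hvx huy hvy hdim)⟩
  simp [hyperbolicSpace_apply]

theorem wittEquivalent_hyperbolicPlane_of_isotropic_family (Q : QuadraticForm F V)
    (S : Submodule F V) (u v : ι → V) (huS : ∀ i, u i ∈ S) (hvS : ∀ i, v i ∈ S)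
    (hu : ∀ i, Q (u i) = 0) (huu : ∀ i j, polar Q (u i) (u j) = 0)
    (huv : ∀ i j, polar Q (u i) (v j) = if i = j then 1 else 0)
    (hdim : Module.finrank F S = 2 * Fintype.card ι) :
    WittEquivalent (Q.comp S.subtype) (hyperbolicPlane F) := by
  -- The added plane plays the role of the binary complement, with both its basis vectors singular.
  let R : QuadraticForm F (S × (Fin 1 → F × F)) := (Q.comp S.subtype).prod (hyperbolicSpace F 1)
  have hR (s : V) (hs : s ∈ S) (p) : R (⟨s, hs⟩, p) = Q s + (p 0).1 * (p 0).2 := by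
    simp [R, hyperbolicSpace_apply]
  have hpolar (s s' : V) (hs hs') (p p') : polar R (⟨s, hs⟩, p) (⟨s', hs'⟩, p') =
      polar Q s s' + ((p 0).1 * (p' 0).2 + (p 0).2 * (p' 0).1) := by
    simp only [polar, Prod.mk_add_mk, AddMemClass.mk_add_mk, hR, Pi.add_apply, Prod.fst_add,
      Prod.snd_add]
    ring
  have h := equivalent_of_isotropic_family R (fun i => (⟨u i, huS i⟩, 0))
    (fun i => (⟨v i, hvS i⟩, 0)) (⟨0, S.zero_mem⟩, fun _ => (1, 0)) (⟨0, S.zero_mem⟩, fun _ => (0, 1))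
    (fun i => by simp [hR, hu]) (fun i j => by simp [hpolar, huu])
    (fun i j => by simp [hpolar, huv]) (by simp [hpolar]) (fun i => by simp [hpolar])
    (fun i => by simp [hpolar]) (fun i => by simp [hpolar]) (fun i => by simp [hpolar])
    (by simp [Module.finrank_prod, Module.finrank_pi_fintype, hdim])
  exact ⟨1, Fintype.card ι, by simpa [hR, hyperbolicPlane] using h⟩

end Witt

/-! ### The second trace form of the tensor square -/

section Trace

variable {F : Type u} {A : Type v} [Field F] [Ring A] [Algebra F A] [FiniteDimensional F A]

/-- A symplectic family, together with its dual family, in a subspace on which a symmetric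
trace form is alternating and nondegenerate. -/
theorem exists_symplectic_family_of_trace (τ : A →ₗ[F] F) (W : Submodule F A)
    (halt : ∀ x ∈ W, τ (x * x) = 0)
    (hnd : ∀ x ∈ W, (∀ y ∈ W, τ (x * y) = 0) → x = 0) :
    ∃ (m : ℕ) (e f : Fin m → A), Module.finrank F W = 2 * m ∧ (∀ i, e i ∈ W) ∧ (∀ i, f i ∈ W) ∧
      (∀ i j, τ (e i * e j) = 0) ∧ (∀ i j, τ (f i * f j) = 0) ∧
      ∀ i j, τ (e i * f j) = if i = j then 1 else 0 := by
  let β : LinearMap.BilinForm F W := ((LinearMap.mul F A).compr₂ τ).compl₁₂ W.subtype W.subtype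
  obtain ⟨m, e, f, hm, hee, hff, hef⟩ := exists_symplectic_family _ β (fun x => halt x x.2)
    (fun x hx => Subtype.ext (hnd x x.2 fun y hy => hx ⟨y, hy⟩)) rfl
  exact ⟨m, fun i => e i, fun i => f i, hm, fun i => (e i).2, fun i => (f i).2, hee, hff, hef⟩

variable [CharP F 2] {E : Type u} [Field E] [Algebra F E] [IsGalois F E]

theorem polar_t2Form_tmul (hdeg : degree F A ≠ 0) (φ : SplittingRep F A E) (a b c d : A) :
    polar (t2Form F (A ⊗[F] A)) (a ⊗ₜ b) (c ⊗ₜ d) =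
      reducedTrace F A a * reducedTrace F A b * (reducedTrace F A c * reducedTrace F A d) +
      reducedTrace F A (a * c) * reducedTrace F A (b * d) := by
  obtain ⟨ψ, -⟩ := exists_splittingRep_tensor (finrank_eq_degree_sq φ) φ
  rw [polar_t2Form (degree_tensor_ne_zero hdeg φ) ψ, Algebra.TensorProduct.tmul_mul_tmul,
    reducedTrace_tmul hdeg φ, reducedTrace_tmul hdeg φ, reducedTrace_tmul hdeg φ,
    CharTwo.sub_eq_add]

theorem wittEquivalent_of_even (hdeg : degree F A ≠ 0) (φ : SplittingRep F A E)
    (heven : Even (degree F A)) :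
    WittEquivalent (secondTraceForm F (A ⊗[F] A))
      (binaryForm (((degree F A).choose 2 : ℕ) : F) ((degree F A).choose 2 : ℕ)) := by
  set τ := reducedTrace F A with hτ
  have h2 : (2 : F) = 0 := CharTwo.two_eq_zero
  have h1 : τ 1 = 0 := by
    rw [hτ, reducedTrace_one hdeg φ]
    exact (CharP.cast_eq_zero_iff F 2 _).2 heven.two_dvd
  have hcomm := reducedTrace_mul_comm hdeg φ
  have hsq (x : A) : τ (x * x) = τ x ^ 2 := by
    rw [reducedTrace_mul_self hdeg φ, h2, zero_mul, sub_zero]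
  have hQ (a b : A) : t2Form F (A ⊗[F] A) (a ⊗ₜ b) =
      τ a ^ 2 * t2Form F A b + t2Form F A a * τ b ^ 2 := by
    rw [t2Form_tmul hdeg φ, h2, zero_mul, sub_zero]
  have hpolar := polar_t2Form_tmul hdeg φ
  rw [← hτ] at hpolar hcomm
  have : Nontrivial A := by
    refine Module.nontrivial_of_finrank_pos (R := F) ?_
    rw [finrank_eq_degree_sq φ]
    positivity
  obtain ⟨g, hg⟩ : ∃ g, τ g = 1 := by
    by_contra! h
    refine one_ne_zero (α := A) (reducedTrace_nondegenerate hdeg φ 1 fun y => ?_)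
    by_contra hy
    exact h ((τ y)⁻¹ • y) (by
      rw [one_mul] at hy
      rw [map_smul, smul_eq_mul, inv_mul_cancel₀ hy])
  have hgg : τ (g * g) = 1 := by rw [hsq, hg, one_pow]
  -- The kernel of `L` is the orthogonal complement of `1` and `g` for the trace pairing; it lies in
  -- `ker τ`, so the pairing is alternating there.
  let L : A →ₗ[F] F × F := τ.prod (τ ∘ₗ LinearMap.mulRight F g)
  have hLrange : LinearMap.range L = ⊤ := by
    rw [LinearMap.range_eq_top]
    intro p
    refine ⟨p.1 • g + (p.2 - p.1) • 1, ?_⟩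
    simp [L, h1, hg, hgg, add_mul]
  have hW (x : A) : x ∈ LinearMap.ker L ↔ τ x = 0 ∧ τ (x * g) = 0 := by simp [L]
  have hWdim : Module.finrank F (LinearMap.ker L) + 2 = degree F A ^ 2 := by
    have h := LinearMap.finrank_range_add_finrank_ker L
    rw [hLrange, finrank_top, Module.finrank_prod, Module.finrank_self,
      finrank_eq_degree_sq φ] at h
    omega
  obtain ⟨m, e, f, hm, he, hf, hee, hff, hef⟩ := exists_symplectic_family_of_trace τ
    (LinearMap.ker L) (fun x hx => by rw [hsq, ((hW x).1 hx).1]; simp) (fun x hx h => by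
      refine reducedTrace_nondegenerate hdeg φ x fun z => ?_
      have hz := h (z - τ z • g - (τ (z * g) - τ z) • 1) ((hW _).2 (by
        simp [h1, hg, hgg, sub_mul]))
      simpa [mul_sub, ((hW x).1 hx).1, ((hW x).1 hx).2] using hz)
  -- `w` is the whole symplectic basis and `w'` its dual basis; no signs appear because the trace
  -- pairing is symmetric.
  let w : Fin m ⊕ Fin m → A := Sum.elim e f
  let w' : Fin m ⊕ Fin m → A := Sum.elim f e
  have hww' (k l) : τ (w k * w' l) = if k = l then 1 else 0 := by
    rcases k with i | i <;> rcases l with j | j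
    · simp [w, w', hef]
    · simp [w, w', hee]
    · simp [w, w', hff]
    · simp [w, w', hcomm (f i), hef, eq_comm]
  have hwW (k) : τ (w k) = 0 ∧ τ (w k * g) = 0 := by
    rcases k with i | i
    exacts [(hW _).1 (he i), (hW _).1 (hf i)]
  have hwW' (k) : τ (w' k) = 0 ∧ τ (w' k * g) = 0 := by
    rcases k with i | i
    exacts [(hW _).1 (hf i), (hW _).1 (he i)]
  have hw1 k := (hwW k).1
  have hw2 k := (hwW k).2
  have hw3 k := (hwW' k).1
  have hw4 k := (hwW' k).2
  have he1 i := ((hW _).1 (he i)).1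
  have he2 i := ((hW _).1 (he i)).2
  have hf1 i := ((hW _).1 (hf i)).1
  have hf2 i := ((hW _).1 (hf i)).2
  have hdegB := degree_tensor (finrank_eq_degree_sq φ)
  have htop : traceFormSpace F (A ⊗[F] A) = ⊤ := if_pos (by
    rw [hdegB]; exact heven.pow_of_ne_zero two_ne_zero)
  clear_value w w'
  have hx : t2Form F (A ⊗[F] A) (1 ⊗ₜ g + 1 ⊗ₜ 1) = ((degree F A).choose 2 : ℕ) := by
    rw [QuadraticMap.map_add (t2Form F _), hpolar, hQ, hQ, t2Form_one hdeg φ]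
    simp [h1, hg]
  have hy : t2Form F (A ⊗[F] A) (g ⊗ₜ 1 + 1 ⊗ₜ 1) = ((degree F A).choose 2 : ℕ) := by
    rw [QuadraticMap.map_add (t2Form F _), hpolar, hQ, hQ, t2Form_one hdeg φ]
    simp [h1, hg]
  -- With `P` the span of `1` and `g`, the index summands treat `W ⊗ W`, `P ⊗ W`, `W ⊗ P` and the
  -- pair `1 ⊗ 1`, `g ⊗ g` of `P ⊗ P`. The remaining `1 ⊗ g` and `g ⊗ 1` are shifted by `1 ⊗ 1` to
  -- become orthogonal to `g ⊗ g`.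
  have key := wittEquivalent_binaryForm_of_isotropic_family
    (ι := (Fin m × (Fin m ⊕ Fin m)) ⊕ (Fin m ⊕ Fin m) ⊕ (Fin m ⊕ Fin m) ⊕ Unit)
    (t2Form F (A ⊗[F] A)) (traceFormSpace F (A ⊗[F] A))
    (Sum.elim (fun p => e p.1 ⊗ₜ w p.2) <| Sum.elim (fun k => 1 ⊗ₜ w k) <|
      Sum.elim (fun k => w k ⊗ₜ 1) fun _ => 1 ⊗ₜ 1)
    (Sum.elim (fun p => f p.1 ⊗ₜ w' p.2) <| Sum.elim (fun k => g ⊗ₜ w' k) <|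
      Sum.elim (fun k => w' k ⊗ₜ g) fun _ => g ⊗ₜ g)
    (1 ⊗ₜ g + 1 ⊗ₜ 1) (g ⊗ₜ 1 + 1 ⊗ₜ 1)
    (fun i => htop ▸ Submodule.mem_top) (fun i => htop ▸ Submodule.mem_top)
    (htop ▸ Submodule.mem_top) (htop ▸ Submodule.mem_top)
    ?_ ?_ ?_ ?_ ?_ ?_ ?_ ?_ ?_
  · rwa [hx, hy] at key
  · rintro (⟨i, k⟩ | k | k | _) <;> simp [hQ, he1, hw1, h1]
  · rintro (⟨i, k⟩ | k | k | _) (⟨j, l⟩ | l | l | _) <;> simp [hpolar, he1, hw1, h1, hee]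
  · rintro (⟨i, k⟩ | k | k | _) (⟨j, l⟩ | l | l | _) <;>
      simp [hpolar, he1, hw1, hw2, hw3, hf1, he2, h1, hg, hef, hww', ← ite_and, and_comm]
  · simp [hpolar, polar_add_left, polar_add_right, h1, hg]
  · rintro (⟨i, k⟩ | k | k | _) <;> simp [hpolar, polar_add_right, he1, hw1, hw2, h1, hg]
  · rintro (⟨i, k⟩ | k | k | _) <;>
      simp [hpolar, polar_add_right, hf1, hw3, hw4, h1, hg, hgg, CharTwo.add_self_eq_zero]
  · rintro (⟨i, k⟩ | k | k | _) <;> simp [hpolar, polar_add_right, he1, hw1, he2, hw2, h1, hg]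
  · rintro (⟨i, k⟩ | k | k | _) <;>
      simp [hpolar, polar_add_right, hf1, hf2, hw3, hw4, h1, hg, hgg, CharTwo.add_self_eq_zero]
  · rw [htop, finrank_top, Module.finrank_tensorProduct, finrank_eq_degree_sq φ, ← hWdim, hm]
    simp
    ring

theorem wittEquivalent_of_odd (hdeg : degree F A ≠ 0) (φ : SplittingRep F A E)
    (hodd : ¬ Even (degree F A)) :
    WittEquivalent (secondTraceForm F (A ⊗[F] A)) (hyperbolicPlane F) := by
  set τ := reducedTrace F A with hτ
  have h2 : (2 : F) = 0 := CharTwo.two_eq_zero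
  have h1 : τ 1 = 1 := by
    rw [hτ, reducedTrace_one hdeg φ]
    obtain ⟨k, hk⟩ := Nat.not_even_iff_odd.1 hodd
    simp [hk, h2]
  have hcomm := reducedTrace_mul_comm hdeg φ
  have hsq (x : A) : τ (x * x) = τ x ^ 2 := by
    rw [reducedTrace_mul_self hdeg φ, h2, zero_mul, sub_zero]
  have hQ (a b : A) : t2Form F (A ⊗[F] A) (a ⊗ₜ b) =
      τ a ^ 2 * t2Form F A b + t2Form F A a * τ b ^ 2 := by
    rw [t2Form_tmul hdeg φ, h2, zero_mul, sub_zero]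
  have hpolar := polar_t2Form_tmul hdeg φ
  have hmul := reducedTrace_tmul hdeg φ
  rw [← hτ] at hpolar hcomm hmul
  have hkerdim {V : Type v} [AddCommGroup V] [Module F V] [FiniteDimensional F V] (θ : V →ₗ[F] F)
      (z : V) (hz : θ z = 1) : Module.finrank F (LinearMap.ker θ) + 1 = Module.finrank F V := by
    have hr : LinearMap.range θ = ⊤ :=
      LinearMap.range_eq_top.2 fun c => ⟨c • z, by simp [hz]⟩
    have h := LinearMap.finrank_range_add_finrank_ker θ
    rw [hr, finrank_top, Module.finrank_self] at h
    omega
  have hWdim := hkerdim τ 1 h1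
  obtain ⟨m, e, f, hm, he, hf, hee, hff, hef⟩ := exists_symplectic_family_of_trace τ
    (LinearMap.ker τ) (fun x hx => by rw [hsq, LinearMap.mem_ker.1 hx]; simp) (fun x hx h => by
      refine reducedTrace_nondegenerate hdeg φ x fun z => ?_
      have hz := h (z - τ z • 1) (by simp [h1])
      simpa [mul_sub, LinearMap.mem_ker.1 hx] using hz)
  let w : Fin m ⊕ Fin m → A := Sum.elim e f
  let w' : Fin m ⊕ Fin m → A := Sum.elim f e
  have hww' (k l) : τ (w k * w' l) = if k = l then 1 else 0 := by
    rcases k with i | i <;> rcases l with j | j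
    · simp [w, w', hef]
    · simp [w, w', hee]
    · simp [w, w', hff]
    · simp [w, w', hcomm (f i), hef, eq_comm]
  have he1 i : τ (e i) = 0 := he i
  have hf1 i : τ (f i) = 0 := hf i
  have hw (k) : τ (w k) = 0 := by
    rcases k with i | i
    exacts [he i, hf i]
  have hw' (k) : τ (w' k) = 0 := by
    rcases k with i | i
    exacts [hf i, he i]
  have hspace : traceFormSpace F (A ⊗[F] A) = LinearMap.ker (reducedTrace F (A ⊗[F] A)) :=
    if_neg (by
      rw [degree_tensor (finrank_eq_degree_sq φ), Nat.even_pow' two_ne_zero]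
      exact hodd)
  clear_value w w'
  -- The trace-zero space is the sum of `W ⊗ W`, `W ⊗ 1` and `1 ⊗ W`. The symmetric elements `w ⊗ 1
  -- + 1 ⊗ w` are singular since the two copies of `t_2(w)` cancel; the dual vectors `w' ⊗ 1` need
  -- not be singular.
  refine wittEquivalent_hyperbolicPlane_of_isotropic_family
    (ι := (Fin m × (Fin m ⊕ Fin m)) ⊕ (Fin m ⊕ Fin m))
    (t2Form F (A ⊗[F] A)) (traceFormSpace F (A ⊗[F] A))
    (Sum.elim (fun p => e p.1 ⊗ₜ w p.2) fun k => w k ⊗ₜ 1 + 1 ⊗ₜ w k)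
    (Sum.elim (fun p => f p.1 ⊗ₜ w' p.2) fun k => w' k ⊗ₜ 1) ?_ ?_ ?_ ?_ ?_ ?_
  · rw [hspace]
    rintro (⟨i, k⟩ | k) <;> simp [hmul, he1, hw]
  · rw [hspace]
    rintro (⟨i, k⟩ | k) <;> simp [hmul, hf1, hw']
  · rintro (⟨i, k⟩ | k)
    · simp [hQ, he1, hw]
    · simp only [Sum.elim_inr]
      rw [QuadraticMap.map_add (t2Form F _), hpolar, hQ, hQ]
      simp [hw, h1, CharTwo.add_self_eq_zero]
  · rintro (⟨i, k⟩ | k) (⟨j, l⟩ | l) <;>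
      simp [hpolar, polar_add_left, polar_add_right, he1, hw, h1, hee, CharTwo.add_self_eq_zero]
  · rintro (⟨i, k⟩ | k) (⟨j, l⟩ | l) <;>
      simp [hpolar, polar_add_left, hw, hw', h1, hf1, hef, hww', ← ite_and, and_comm]
  · have hBdim := hkerdim (reducedTrace F (A ⊗[F] A)) (1 ⊗ₜ 1) (by rw [hmul, h1, one_mul])
    rw [Module.finrank_tensorProduct, ← hWdim, hm] at hBdim
    rw [hspace]
    simp
    linarith

end Trace

end SecondTrace

theorem corollary4 {F : Type u} {A : Type v} [Field F] [CharP F 2] [Ring A] [Algebra F A]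
    [FiniteDimensional F A] [Algebra.IsCentral F A] [IsSimpleRing A] :
    (SecondTrace.degree F A % 4 = 2 →
      SecondTrace.WittEquivalent (SecondTrace.secondTraceForm F (A ⊗[F] A))
        (SecondTrace.binaryForm (1 : F) 1)) ∧
    (SecondTrace.degree F A % 4 ≠ 2 →
      SecondTrace.WittEquivalent (SecondTrace.secondTraceForm F (A ⊗[F] A))
        (SecondTrace.hyperbolicPlane F)) := by
  obtain ⟨hdeg, ⟨φ⟩⟩ := SecondTrace.nonempty_splittingRep_separableClosure F A
  have hchoose (k : ℕ) : (2 * k).choose 2 = k * (2 * k - 1) := by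
    rw [Nat.choose_two_right, mul_assoc, Nat.mul_div_cancel_left _ two_pos]
  refine ⟨fun h => ?_, fun h => ?_⟩
  · have key := SecondTrace.wittEquivalent_of_even hdeg φ (Nat.even_iff.2 (by omega))
    -- For `n = 2(2k + 1)` the binomial coefficient is `(2k + 1)(4k + 1)`, which is odd.
    have hc : (((SecondTrace.degree F A).choose 2 : ℕ) : F) = 1 := by
      obtain ⟨k, hk⟩ : ∃ k, SecondTrace.degree F A = 2 * (2 * k + 1) :=
        ⟨SecondTrace.degree F A / 4, by omega⟩
      rw [hk, hchoose, show 2 * (2 * k + 1) - 1 = 2 * (2 * k) + 1 by omega]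
      push_cast
      simp [CharTwo.two_eq_zero]
    rwa [hc] at key
  · by_cases heven : Even (SecondTrace.degree F A)
    · have key := SecondTrace.wittEquivalent_of_even hdeg φ heven
      have hc : (((SecondTrace.degree F A).choose 2 : ℕ) : F) = 0 := by
        have := Nat.even_iff.1 heven
        obtain ⟨k, hk⟩ : ∃ k, SecondTrace.degree F A = 2 * (2 * k) :=
          ⟨SecondTrace.degree F A / 4, by omega⟩
        rw [hk, hchoose]
        push_cast
        simp [CharTwo.two_eq_zero]
      -- The leftover form `[0, 0]` is the hyperbolic plane by definition.
      rwa [hc] at key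
    · exact SecondTrace.wittEquivalent_of_odd hdeg φ heven
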